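/- All Hilbert spaces are finite-dimensional, $\log_2 0=-\infty$, $\log_2(1/0)=+\infty$, and all entropies take values in $[-\infty,+\infty]$. A state is a positive semidefinite (PSD) operator of trace one; $\mathcal D_{\leq}$ is the set of PSD operators of trace at most one. For PSD operators let $F(\omega,\tau)=\|\sqrt{\omega}\sqrt{\tau}\|_1^2$. For $\alpha\in(0,1)\cup(1,\infty)$ let $$\widetilde D_\alpha(\rho\|\sigma)=\frac{1}{\alpha-1}\log_2\operatorname{Tr}\Big[\big(\sigma^{\frac{1-\alpha}{2\alpha}}\rho\,\sigma^{\frac{1-\alpha}{2\alpha}}\big)^\alpha\Big]$$ if $\alpha<1$ or $\operatorname{supp}\rho\subseteq\operatorname{supp}\sigma$, and $\widetilde D_\alpha(\rho\|\sigma)=+\infty$ otherwise (negative powers are taken on the support). Let $D_{\max}(\rho\|\sigma)=\log_2\inf\{\lambda\ge 0:\rho\le\lambda\sigma\}$. For $\varepsilon\in[0,1]$ let $B_\varepsilon(\rho)=\{\widetilde\rho\in\mathcal D_{\leq}:F(\widetilde\rho,\rho)\ge 1-\varepsilon\}$ and $$\widetilde D^{\varepsilon}_\alpha(\rho\|\sigma)=\begin{cases}\inf_{\widetilde\rho\in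 B_\varepsilon(\rho)}\widetilde D_\alpha(\widetilde\rho\|\sigma),&\alpha>1,\\ \sup_{\widetilde\rho\in B_\varepsilon(\rho)}\widetilde D_\alpha(\widetilde\rho\|\sigma),&\alpha<1,\end{cases}$$ $$D^{\varepsilon}_{\max}(\rho\|\sigma)=\inf_{\widetilde\rho\in B_\varepsilon(\rho)}D_{\max}(\widetilde\rho\|\sigma),\qquad D^{\varepsilon}_{\min,F}(\rho\|\sigma)=-\log_2\inf_{\widetilde\rho\in B_\varepsilon(\rho)}F(\widetilde\rho,\sigma).$$ **Theorem.** Let $\rho$ be a state and $\sigma$ a PSD operator. (1) Let $\varepsilon_1,\varepsilon_2\in[0,1]$ with $\varepsilon_1+\varepsilon_2\le 1$ and let $\varepsilon'=\big[\sqrt{\varepsilon_1}\sqrt{1-\varepsilon_2}+\sqrt{1-\varepsilon_1}\sqrt{\varepsilon_2}\big]^2$. Then $\varepsilon'\in[0,1]$. If moreover $\varepsilon_1\neq 1$ (for $\varepsilon_1=1$, $\varepsilon_2=0$ the left-hand sides below are the undefined expression $(-\infty)+(+\infty)$), then (a) for every $\alpha\in(1/2,1)$ and $\beta=\frac{\alpha}{2\alpha-1}$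 one has $\beta>1$ and $$\widetilde D^{\varepsilon_1}_\beta(\rho\|\sigma)+\frac{\beta}{\beta-1}\log_2\Big(\frac{1}{1-\varepsilon'}\Big)\ \ge\ \widetilde D^{\varepsilon_2}_\alpha(\rho\|\sigma);$$ (b) $$D^{\varepsilon_1}_{\max}(\rho\|\sigma)+\log_2\Big(\frac{1}{1-\varepsilon'}\Big)\ \ge\ D^{\varepsilon_2}_{\min,F}(\rho\|\sigma).$$ (2) For every $\varepsilon\in[0,1)$ and every $\beta>1$, $$\widetilde D_\beta(\rho\|\sigma)+\frac{\beta}{\beta-1}\log_2\Big(\frac{1}{1-\varepsilon}\Big)\ \ge\ D^{\varepsilon}_{\min,F}(\rho\|\sigma).$$ -/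

import Mathlib

open scoped ENNReal NNReal ComplexOrder

noncomputable section

namespace SmoothMinF

/-- The base-two logarithm of an extended nonnegative real number, with `log₂ 0 = -∞` and
`log₂ ∞ = +∞`. -/
def log2 (x : ℝ≥0∞) : EReal := ENNReal.log x / ((Real.log 2 : ℝ) : EReal)

section Operators

variable {n : Type*} [Fintype n] [DecidableEq n]

/-- The real power `A ^ s` of a positive semidefinite matrix, by functional calculus.
Since `(0 : ℝ) ^ s = 0` for `s ≠ 0`, a negative power is taken on the support of `A`. -/
def psdPow (A : Matrix n n ℂ) (s : ℝ) : Matrix n n ℂ := cfc (fun x : ℝ => x ^ s) A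

/-- The trace norm `‖B‖₁ = Tr √(Bᴴ B)`. -/
def traceNorm (B : Matrix n n ℂ) : ℝ := (psdPow (B.conjTranspose * B) (1 / 2)).trace.re

/-- The (squared) fidelity `F(ω, τ) = ‖√ω √τ‖₁ ^ 2` of positive semidefinite matrices. -/
def fidelity (ω τ : Matrix n n ℂ) : ℝ := traceNorm (psdPow ω (1 / 2) * psdPow τ (1 / 2)) ^ 2

/-- Quantum states: positive semidefinite, unit trace. -/
def IsState (ρ : Matrix n n ℂ) : Prop := ρ.PosSemidef ∧ ρ.trace = 1

/-- Subnormalized states: positive semidefinite, trace at most one. -/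
def IsSubState (ρ : Matrix n n ℂ) : Prop := ρ.PosSemidef ∧ ρ.trace.re ≤ 1

/-- The subnormalized states `ρ'` with `F(ρ', ρ) ≥ 1 - ε`. -/
def nearby (ε : ℝ) (ρ : Matrix n n ℂ) : Set (Matrix n n ℂ) :=
  {ρ' | IsSubState ρ' ∧ 1 - ε ≤ fidelity ρ' ρ}

/-- The support of an operator: the orthogonal complement of its kernel. -/
def supp (X : Matrix n n ℂ) : Submodule ℂ (EuclideanSpace ℂ n) :=
  (LinearMap.ker (Matrix.toEuclideanLin X))ᗮ

/-- `Q_α(ρ‖σ) = Tr[(σ^((1-α)/(2α)) ρ σ^((1-α)/(2α)))^α]`. -/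
def sandwichedQ (α : ℝ) (ρ σ : Matrix n n ℂ) : ℝ :=
  (psdPow (psdPow σ ((1 - α) / (2 * α)) * ρ * psdPow σ ((1 - α) / (2 * α))) α).trace.re

open Classical in
/-- The sandwiched Rényi relative entropy of order `α ∈ (0,1) ∪ (1,∞)`. -/
def sandwichedRenyi (α : ℝ) (ρ σ : Matrix n n ℂ) : EReal :=
  if α < 1 ∨ supp ρ ≤ supp σ then
    ((1 / (α - 1) : ℝ) : EReal) * log2 (ENNReal.ofReal (sandwichedQ α ρ σ))
  else ⊤

open Classical in
/-- The smooth sandwiched Rényi relative entropy of order `α ∈ (0,1) ∪ (1,∞)`: a supremum over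
nearby subnormalized states for `α < 1`, an infimum for `α > 1`. -/
def smoothSandwichedRenyi (ε α : ℝ) (ρ σ : Matrix n n ℂ) : EReal :=
  if α < 1 then ⨆ ρ' ∈ nearby ε ρ, sandwichedRenyi α ρ' σ
  else ⨅ ρ' ∈ nearby ε ρ, sandwichedRenyi α ρ' σ

/-- The max-relative entropy `log₂ inf {l ≥ 0 : ρ ≤ l σ}` (the infimum of `∅` is `+∞`). -/
def maxRelEntropy (ρ σ : Matrix n n ℂ) : EReal :=
  log2 (⨅ l ∈ {l : ℝ≥0 | (((l : ℝ) : ℂ) • σ - ρ).PosSemidef}, (l : ℝ≥0∞))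

/-- The smooth max-relative entropy. -/
def smoothMaxRelEntropy (ε : ℝ) (ρ σ : Matrix n n ℂ) : EReal :=
  ⨅ ρ' ∈ nearby ε ρ, maxRelEntropy ρ' σ

/-- The fidelity-based smooth min-relative entropy. -/
def smoothMinFRelEntropy (ε : ℝ) (ρ σ : Matrix n n ℂ) : EReal :=
  -log2 (⨅ ρ' ∈ nearby ε ρ, ENNReal.ofReal (fidelity ρ' σ))

end Operators

/-- `ε' = [√ε₁ √(1-ε₂) + √(1-ε₁) √ε₂]²`. -/
def epsPrime (ε₁ ε₂ : ℝ) : ℝ := (√ε₁ * √(1 - ε₂) + √(1 - ε₁) * √ε₂) ^ 2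

end SmoothMinF

end

open scoped ENNReal NNReal ComplexOrder

noncomputable section

namespace SmoothMinF

section Operators

open Matrix

variable {n : Type*} [Fintype n] [DecidableEq n]

/-! ### Hölder inequalities for finite weighted sums -/

/-! Everything rests on upper and lower bounds for the fidelity of two nearby operators `ρ₀`, `ρ₁`.
With `εᵢ = sin² θᵢ` one has `1 - ε' = cos² (θ₁ + θ₂)`, so the triangle inequality for the fidelity
angle gives `1 - ε' ≤ F(ρ₀, ρ₁)` (`one_sub_epsPrime_le_fidelity`).

The upper bounds are `F(ρ₀, ρ₁) ≤ Q_β(ρ₀‖σ)^(1/β) Q_α(ρ₁‖σ)^(1/α)` for (1a), `F(ρ₀, ρ₁) ≤ l F(ρ₁,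
σ)` when `ρ₀ ≤ l σ` for (1b), and `F(ρ₀, ρ₁) ≤ Q_β(ρ₀‖σ)^(1/β) F(ρ₁, σ)^((β-1)/β)` for (2). In (2)
the first operator is `ρ` itself, so `1 - ε` bounds the fidelity directly. Taking logarithms and
optimizing over the nearby operators gives the entropy inequalities.

The bounds with `Q` insert powers of `σ` between `√ρ₀` and `√ρ₁` and apply a Schatten Hölder
inequality (`norm_trace_sq_le_holder`). That inequality is made scalar by expanding the trace in two
eigenbases: Cauchy-Schwarz splits off one factor, and the squared entries of a contraction are
doubly substochastic weights. -/

lemma sum_weight_mul_le {ι : Type*} (s : Finset ι) (w a b : ι → ℝ) (hw : ∀ i ∈ s, 0 ≤ w i)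
    (ha : ∀ i ∈ s, 0 ≤ a i) (hb : ∀ i ∈ s, 0 ≤ b i) {p q : ℝ} (hpq : p.HolderConjugate q) :
    ∑ i ∈ s, w i * (a i * b i) ≤
      (∑ i ∈ s, w i * a i ^ p) ^ (1 / p) * (∑ i ∈ s, w i * b i ^ q) ^ (1 / q) := by
  have h := Real.inner_le_Lp_mul_Lq_of_nonneg s (f := fun i => w i ^ (1 / p) * a i)
    (g := fun i => w i ^ (1 / q) * b i) hpq
    (fun i hi => mul_nonneg (Real.rpow_nonneg (hw i hi) _) (ha i hi))
    (fun i hi => mul_nonneg (Real.rpow_nonneg (hw i hi) _) (hb i hi))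
  have hp := hpq.pos
  have hq := hpq.symm.pos
  convert h using 1
  · refine Finset.sum_congr rfl fun i hi => ?_
    have : w i = w i ^ (1 / p) * w i ^ (1 / q) := by
      rw [← Real.rpow_add' (hw i hi)]
      · simp [hpq.inv_add_inv_eq_one]
      · simp [hpq.inv_add_inv_eq_one]
    nth_rw 1 [this]; ring
  · congr 2 <;> refine Finset.sum_congr rfl fun i hi => ?_
    · rw [Real.mul_rpow (Real.rpow_nonneg (hw i hi) _) (ha i hi), ← Real.rpow_mul (hw i hi)]
      simp [hp.ne']
    · rw [Real.mul_rpow (Real.rpow_nonneg (hw i hi) _) (hb i hi), ← Real.rpow_mul (hw i hi)]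
      simp [hq.ne']

lemma sum_weight_rpow_le {ι : Type*} (s : Finset ι) (w x : ι → ℝ) (hw : ∀ i ∈ s, 0 ≤ w i)
    (hx : ∀ i ∈ s, 0 ≤ x i) {t : ℝ} (h0 : 0 < t) (h1 : t < 1) :
    ∑ i ∈ s, w i * x i ^ t ≤ (∑ i ∈ s, w i * x i) ^ t * (∑ i ∈ s, w i) ^ (1 - t) := by
  have hpq : (1 / t).HolderConjugate (1 / (1 - t)) := by
    rw [Real.holderConjugate_iff]
    exact ⟨by rw [lt_div_iff₀ h0]; linarith, by simp⟩
  have h := sum_weight_mul_le s w (fun i => x i ^ t) (fun _ => 1) hw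
    (fun i hi => Real.rpow_nonneg (hx i hi) _) (fun _ _ => zero_le_one) hpq
  simp only [one_div_one_div, Real.one_rpow, mul_one] at h
  refine h.trans_eq ?_
  congr 2
  refine Finset.sum_congr rfl fun i hi => ?_
  rw [← Real.rpow_mul (hx i hi), mul_one_div_cancel h0.ne', Real.rpow_one]

/-! ### Functional calculus of Hermitian matrices -/

lemma continuousOn_spectrum (f : ℝ → ℝ) (A : Matrix n n ℂ) : ContinuousOn f (spectrum ℝ A) :=
  A.finite_real_spectrum.continuousOn f

/-- The unitary matrix of an eigenbasis of `A`. -/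
def eigenMatrix {A : Matrix n n ℂ} (hA : A.IsHermitian) : Matrix n n ℂ := hA.eigenvectorUnitary

lemma cfc_eq_conj {A : Matrix n n ℂ} (hA : A.IsHermitian) (f : ℝ → ℝ) :
    cfc f A = eigenMatrix hA *
      diagonal (fun i => (f (hA.eigenvalues i) : ℂ)) * (eigenMatrix hA)ᴴ := by
  rw [hA.cfc_eq, IsHermitian.cfc, Unitary.conjStarAlgAut_apply]
  rfl

lemma cfc_isHermitian (f : ℝ → ℝ) (A : Matrix n n ℂ) : (cfc f A).IsHermitian :=
  IsSelfAdjoint.cfc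

lemma eigenMatrix_conjTranspose_mul {A : Matrix n n ℂ} (hA : A.IsHermitian) :
    (eigenMatrix hA)ᴴ * eigenMatrix hA = 1 :=
  Unitary.coe_star_mul_self _

/-- Noncommuting `A` and `B` are each diagonalized in their own eigenbasis, which turns trace
inequalities into inequalities for sums over pairs of eigenvalues. -/
lemma trace_cfc_mul_mul_cfc_mul {A B : Matrix n n ℂ} (hA : A.IsHermitian) (hB : B.IsHermitian)
    (f g : ℝ → ℝ) (M N : Matrix n n ℂ) :
    (cfc f A * M * cfc g B * N).trace = ∑ x : n × n, (f (hA.eigenvalues x.1) : ℂ) *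
      ((eigenMatrix hA)ᴴ * M * eigenMatrix hB) x.1 x.2 *
      (g (hB.eigenvalues x.2) : ℂ) *
      ((eigenMatrix hB)ᴴ * N * eigenMatrix hA) x.2 x.1 := by
  rw [cfc_eq_conj hA, cfc_eq_conj hB]
  set U := eigenMatrix hA
  set V := eigenMatrix hB
  set D := diagonal (fun i => (f (hA.eigenvalues i) : ℂ))
  set E := diagonal (fun i => (g (hB.eigenvalues i) : ℂ))
  have : (U * D * Uᴴ * M * (V * E * Vᴴ) * N).trace =
      ((D * (Uᴴ * M * V)) * (E * (Vᴴ * N * U))).trace := by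
    rw [show U * D * Uᴴ * M * (V * E * Vᴴ) * N = U * (D * Uᴴ * M * (V * E * Vᴴ) * N) by
      simp only [Matrix.mul_assoc], Matrix.trace_mul_comm]
    simp only [Matrix.mul_assoc]
  rw [this, Fintype.sum_prod_type]
  simp only [trace, diag_apply, Matrix.mul_apply (M := D * _), D, E, Matrix.diagonal_mul]
  refine Finset.sum_congr rfl fun i _ => Finset.sum_congr rfl fun j _ => ?_
  ring

lemma trace_cfc {A : Matrix n n ℂ} (hA : A.IsHermitian) (f : ℝ → ℝ) :
    (cfc f A).trace.re = ∑ i, f (hA.eigenvalues i) := by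
  rw [cfc_eq_conj hA, Matrix.trace_mul_comm, ← Matrix.mul_assoc,
    eigenMatrix_conjTranspose_mul, Matrix.one_mul, trace_diagonal]
  simp

lemma trace_conjTranspose_mul_self {m : Type*} [Fintype m] (Y : Matrix m m ℂ) :
    (Yᴴ * Y).trace.re = ∑ x : m × m, ‖Y x.1 x.2‖ ^ 2 := by
  rw [Fintype.sum_prod_type_right]
  simp [trace, Matrix.mul_apply, ← Complex.normSq_eq_norm_sq, Complex.normSq_apply]

/-! ### Powers of positive semidefinite matrices -/

lemma psdPow_conjTranspose (A : Matrix n n ℂ) (s : ℝ) : (psdPow A s)ᴴ = psdPow A s :=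
  (cfc_isHermitian _ A).eq

lemma cfc_posSemidef {A : Matrix n n ℂ} (hA : A.PosSemidef) {f : ℝ → ℝ}
    (hf : ∀ x, 0 ≤ x → 0 ≤ f x) : (cfc f A).PosSemidef := by
  rw [cfc_eq_conj hA.isHermitian]
  refine PosSemidef.mul_mul_conjTranspose_same (PosSemidef.diagonal fun i => ?_) _
  exact Complex.zero_le_real.mpr (hf _ (hA.eigenvalues_nonneg i))

lemma psdPow_posSemidef {A : Matrix n n ℂ} (hA : A.PosSemidef) (s : ℝ) : (psdPow A s).PosSemidef :=
  cfc_posSemidef hA fun _ hx => Real.rpow_nonneg hx s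

lemma cfc_congr_psd {A : Matrix n n ℂ} (hA : A.PosSemidef) {f g : ℝ → ℝ}
    (h : ∀ x, 0 ≤ x → f x = g x) : cfc f A = cfc g A := by
  simp only [cfc_eq_conj hA.isHermitian, h _ (hA.eigenvalues_nonneg _)]

/-- The case `s + t = 0` is excluded because `0 ^ 0 = 1`: the right side would be the identity,
while for `s ≠ 0` the product is only the support projection. -/
lemma psdPow_mul_psdPow {A : Matrix n n ℂ} (hA : A.PosSemidef) {s t : ℝ} (h : s + t ≠ 0) :
    psdPow A s * psdPow A t = psdPow A (s + t) := by
  rw [psdPow, psdPow, ← cfc_mul _ _ A (continuousOn_spectrum _ _) (continuousOn_spectrum _ _)]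
  exact cfc_congr_psd hA fun x hx => (Real.rpow_add' hx h).symm

lemma psdPow_one {A : Matrix n n ℂ} (hA : A.PosSemidef) : psdPow A 1 = A := by
  simp only [psdPow, Real.rpow_one]
  exact cfc_id' ℝ A hA.isHermitian

lemma sqrt_mul_sqrt {A : Matrix n n ℂ} (hA : A.PosSemidef) :
    psdPow A (1 / 2) * psdPow A (1 / 2) = A := by
  rw [psdPow_mul_psdPow hA (by norm_num)]
  norm_num [psdPow_one hA]

lemma trace_psdPow {A : Matrix n n ℂ} (hA : A.PosSemidef) (s : ℝ) :
    (psdPow A s).trace.re = ∑ i, hA.isHermitian.eigenvalues i ^ s :=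
  trace_cfc _ _

lemma trace_psdPow_nonneg {A : Matrix n n ℂ} (hA : A.PosSemidef) (s : ℝ) :
    0 ≤ (psdPow A s).trace.re := by
  rw [trace_psdPow hA]
  exact Finset.sum_nonneg fun i _ => Real.rpow_nonneg (hA.eigenvalues_nonneg i) _

/-- The projection onto the support of `A`. -/
def suppProj (A : Matrix n n ℂ) : Matrix n n ℂ := cfc (fun x : ℝ => if x = 0 then 0 else 1) A

lemma suppProj_conjTranspose (A : Matrix n n ℂ) : (suppProj A)ᴴ = suppProj A :=
  (cfc_isHermitian _ A).eq

lemma suppProj_mul_self (A : Matrix n n ℂ) : suppProj A * suppProj A = suppProj A := by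
  rw [suppProj, ← cfc_mul _ _ A (continuousOn_spectrum _ _) (continuousOn_spectrum _ _)]
  congr 1
  ext x
  split_ifs <;> simp

lemma psdPow_mul_psdPow_neg {A : Matrix n n ℂ} (hA : A.PosSemidef) {s t : ℝ} (hs : s ≠ 0)
    (h : s + t = 0) : psdPow A s * psdPow A t = suppProj A := by
  obtain rfl : t = -s := by linarith
  rw [psdPow, psdPow, ← cfc_mul _ _ A (continuousOn_spectrum _ _) (continuousOn_spectrum _ _)]
  refine cfc_congr_psd hA fun x hx => ?_
  rcases hx.eq_or_lt with rfl | hx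
  · simp [Real.zero_rpow hs]
  · simp [← Real.rpow_add hx, hx.ne']

lemma psdPow_mul_suppProj {A : Matrix n n ℂ} (hA : A.PosSemidef) {s : ℝ} (hs : s ≠ 0) :
    psdPow A s * suppProj A = psdPow A s := by
  rw [psdPow, suppProj, ← cfc_mul _ _ A (continuousOn_spectrum _ _) (continuousOn_spectrum _ _)]
  refine cfc_congr_psd hA fun x hx => ?_
  rcases hx.eq_or_lt with rfl | hx
  · simp [Real.zero_rpow hs]
  · simp [hx.ne']

lemma mul_one_sub_suppProj {A : Matrix n n ℂ} (hA : A.PosSemidef) : A * (1 - suppProj A) = 0 := by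
  have := psdPow_mul_suppProj hA one_ne_zero
  rw [psdPow_one hA] at this
  rw [Matrix.mul_sub, Matrix.mul_one, this, sub_self]

/-- Testing the kernel condition on `M = 1 - suppProj A` suffices. Support hypotheses enter through
this lemma, to cancel a power of `A` against its inverse. -/
lemma mul_suppProj_of_ker {A B : Matrix n n ℂ} (hA : A.PosSemidef)
    (h : ∀ M : Matrix n n ℂ, A * M = 0 → B * M = 0) : B * suppProj A = B := by
  have := h _ (mul_one_sub_suppProj hA)
  rwa [Matrix.mul_sub, Matrix.mul_one, sub_eq_zero, eq_comm] at this

lemma psdPow_mul_eq_zero {A : Matrix n n ℂ} (hA : A.PosSemidef) {s t : ℝ} (hs : s ≠ 0)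
    {M : Matrix n n ℂ} (h : psdPow A t * M = 0) : psdPow A s * M = 0 := by
  have : psdPow A s = psdPow A (s - t) * psdPow A t := by
    rw [psdPow_mul_psdPow hA (by simpa using hs), sub_add_cancel]
  rw [this, Matrix.mul_assoc, h, Matrix.mul_zero]

/-! ### Contractions and the polar decomposition -/

/-- Contractions: `Kᴴ K ≤ 1`. -/
def IsContraction (K : Matrix n n ℂ) : Prop := (1 - Kᴴ * K).PosSemidef

lemma isContraction_one : IsContraction (1 : Matrix n n ℂ) := by
  simp [IsContraction, PosSemidef.zero]

lemma IsContraction.mul {K L : Matrix n n ℂ} (hK : IsContraction K) (hL : IsContraction L) :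
    IsContraction (K * L) := by
  have := hL.add (hK.conjTranspose_mul_mul_same L)
  unfold IsContraction
  convert this using 1
  simp only [conjTranspose_mul, Matrix.mul_sub, Matrix.sub_mul, Matrix.mul_one, Matrix.mul_assoc]
  abel

/-- Follows from `1 - K Kᴴ = (1 - K Kᴴ)² + K (1 - Kᴴ K) Kᴴ`. -/
lemma IsContraction.conjTranspose {K : Matrix n n ℂ} (hK : IsContraction K) :
    IsContraction Kᴴ := by
  have h1 := posSemidef_conjTranspose_mul_self (1 - K * Kᴴ)
  have h2 := h1.add (hK.mul_mul_conjTranspose_same K)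
  unfold IsContraction
  convert h2 using 1
  simp only [conjTranspose_mul, conjTranspose_conjTranspose, conjTranspose_sub, conjTranspose_one,
    Matrix.mul_sub, Matrix.sub_mul, Matrix.mul_one, Matrix.one_mul, Matrix.mul_assoc]
  abel

lemma isContraction_suppProj (A : Matrix n n ℂ) : IsContraction (suppProj A) := by
  unfold IsContraction
  convert posSemidef_conjTranspose_mul_self (1 - suppProj A) using 1
  simp only [conjTranspose_sub, conjTranspose_one, suppProj_conjTranspose, suppProj_mul_self,
    Matrix.mul_sub, Matrix.sub_mul, Matrix.mul_one, Matrix.one_mul]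
  abel

lemma isContraction_eigenMatrix {A : Matrix n n ℂ} (hA : A.IsHermitian) :
    IsContraction (eigenMatrix hA) := by
  simp [IsContraction, eigenMatrix_conjTranspose_mul, PosSemidef.zero]

lemma IsContraction.sum_col_le {K : Matrix n n ℂ} (hK : IsContraction K) (j : n) :
    ∑ i, ‖K i j‖ ^ 2 ≤ 1 := by
  have h := hK.diag_nonneg (i := j)
  have h' := (Complex.le_def.mp h).1
  simp only [Complex.zero_re, Matrix.sub_apply, one_apply_eq, Matrix.mul_apply, conjTranspose_apply,
    Complex.sub_re, Complex.one_re, Complex.re_sum] at h'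
  have : ∀ i, (star (K i j) * K i j).re = ‖K i j‖ ^ 2 := fun i => by
    simp [← Complex.normSq_eq_norm_sq, Complex.normSq_apply]
  simp only [this] at h'
  linarith

lemma IsContraction.sum_row_le {K : Matrix n n ℂ} (hK : IsContraction K) (i : n) :
    ∑ j, ‖K i j‖ ^ 2 ≤ 1 := by
  simpa using hK.conjTranspose.sum_col_le i

lemma IsContraction.trace_conj_le {K : Matrix n n ℂ} (hK : IsContraction K) (Y : Matrix n n ℂ) :
    ((K * Y)ᴴ * (K * Y)).trace.re ≤ (Yᴴ * Y).trace.re := by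
  have h := (hK.conjTranspose_mul_mul_same Y).trace_nonneg
  have h' := (Complex.le_def.mp h).1
  rw [Matrix.mul_sub, Matrix.sub_mul, trace_sub] at h'
  simp only [conjTranspose_mul, Matrix.mul_one, Matrix.mul_assoc, Complex.sub_re,
    Complex.zero_re] at h' ⊢
  linarith

/-- The partial isometry in the polar decomposition of `X`. -/
def polar (X : Matrix n n ℂ) : Matrix n n ℂ := X * psdPow (Xᴴ * X) (-(1 / 2))

lemma polar_conjTranspose_mul (X : Matrix n n ℂ) : (polar X)ᴴ * X = psdPow (Xᴴ * X) (1 / 2) := by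
  have h := posSemidef_conjTranspose_mul_self X
  rw [polar, conjTranspose_mul, psdPow_conjTranspose, Matrix.mul_assoc]
  conv_lhs => rhs; rw [← psdPow_one h]
  rw [psdPow_mul_psdPow h (by norm_num)]
  norm_num

lemma isContraction_polar (X : Matrix n n ℂ) : IsContraction (polar X) := by
  have h := posSemidef_conjTranspose_mul_self X
  have : (polar X)ᴴ * polar X = suppProj (Xᴴ * X) := by
    nth_rw 2 [polar]
    rw [← Matrix.mul_assoc, polar_conjTranspose_mul,
      psdPow_mul_psdPow_neg h (by norm_num) (by norm_num)]
  unfold IsContraction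
  have h2 := isContraction_suppProj (Xᴴ * X)
  rwa [IsContraction, suppProj_conjTranspose, suppProj_mul_self, ← this] at h2

lemma mul_suppProj_self (X : Matrix n n ℂ) : X * suppProj (Xᴴ * X) = X :=
  mul_suppProj_of_ker (posSemidef_conjTranspose_mul_self X) fun M hM =>
    (conjTranspose_mul_self_mul_eq_zero X M).mp hM

lemma polar_mul (X : Matrix n n ℂ) : polar X * psdPow (Xᴴ * X) (1 / 2) = X := by
  have h := posSemidef_conjTranspose_mul_self X
  rw [polar, Matrix.mul_assoc, psdPow_mul_psdPow_neg h (by norm_num) (by norm_num),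
    mul_suppProj_self]

lemma IsContraction.trace_conj_le_right {K : Matrix n n ℂ} (hK : IsContraction K)
    (Y : Matrix n n ℂ) : ((Y * K)ᴴ * (Y * K)).trace.re ≤ (Y * Yᴴ).trace.re := by
  have h := hK.conjTranspose.trace_conj_le Yᴴ
  rwa [← conjTranspose_mul, conjTranspose_conjTranspose, conjTranspose_conjTranspose,
    Matrix.trace_mul_comm] at h

lemma norm_trace_conjTranspose_mul_sq_le {m : Type*} [Fintype m] (X Y : Matrix m m ℂ) :
    ‖(Xᴴ * Y).trace‖ ^ 2 ≤ (Xᴴ * X).trace.re * (Yᴴ * Y).trace.re := by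
  have h : (Xᴴ * Y).trace = ∑ x : m × m, star (X x.1 x.2) * Y x.1 x.2 := by
    rw [Fintype.sum_prod_type_right]
    simp [trace, Matrix.mul_apply]
  rw [trace_conjTranspose_mul_self, trace_conjTranspose_mul_self, h]
  refine le_trans (pow_le_pow_left₀ (norm_nonneg _) (norm_sum_le _ _) 2) ?_
  simp only [norm_mul, norm_star]
  exact Finset.sum_mul_sq_le_sq_mul_sq _ _ _

/-- In the weighted Hölder inequality each factor depends on one index only, so summing the weights
over the other index gives at most one. -/
lemma sum_substochastic_le {K : Matrix n n ℂ} (hK : IsContraction K) {x y : n → ℝ}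
    (hx : ∀ i, 0 ≤ x i) (hy : ∀ i, 0 ≤ y i) {p q : ℝ} (hpq : p.HolderConjugate q) :
    ∑ z : n × n, ‖K z.1 z.2‖ ^ 2 * (x z.1 * y z.2) ≤
      (∑ i, x i ^ p) ^ (1 / p) * (∑ j, y j ^ q) ^ (1 / q) := by
  refine (sum_weight_mul_le Finset.univ (fun z : n × n => ‖K z.1 z.2‖ ^ 2) (fun z => x z.1)
    (fun z => y z.2) (fun _ _ => by positivity)
    (fun _ _ => hx _) (fun _ _ => hy _) hpq).trans ?_
  have hp := hpq.pos
  have hq := hpq.symm.pos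
  have hxp : ∀ i, 0 ≤ x i ^ p := fun i => Real.rpow_nonneg (hx i) _
  have hyq : ∀ i, 0 ≤ y i ^ q := fun i => Real.rpow_nonneg (hy i) _
  refine mul_le_mul (Real.rpow_le_rpow ?_ ?_ (by positivity))
    (Real.rpow_le_rpow ?_ ?_ (by positivity)) ?_ ?_
  · exact Finset.sum_nonneg fun z _ => mul_nonneg (by positivity) (hxp _)
  · rw [Fintype.sum_prod_type]
    refine Finset.sum_le_sum fun i _ => ?_
    simp only [← Finset.sum_mul]
    exact mul_le_of_le_one_left (hxp i) (hK.sum_row_le i)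
  · exact Finset.sum_nonneg fun z _ => mul_nonneg (by positivity) (hyq _)
  · rw [Fintype.sum_prod_type_right]
    refine Finset.sum_le_sum fun i _ => ?_
    simp only [← Finset.sum_mul]
    exact mul_le_of_le_one_left (hyq i) (hK.sum_col_le i)
  · exact Real.rpow_nonneg (Finset.sum_nonneg fun z _ => mul_nonneg (by positivity) (hyq _)) _
  · exact Real.rpow_nonneg (Finset.sum_nonneg fun i _ => hxp i) _

/-- A Hölder inequality for the Schatten norms. -/
lemma norm_trace_sq_le_holder {A B K : Matrix n n ℂ} (hA : A.PosSemidef) (hB : B.PosSemidef)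
    (hK : IsContraction K) (Y : Matrix n n ℂ) {p q : ℝ} (hpq : p.HolderConjugate q) (a b : ℝ) :
    ‖(psdPow A a * K * psdPow B b * Y).trace‖ ^ 2 ≤
      (psdPow A (2 * a * p)).trace.re ^ (1 / p) * (psdPow B (2 * b * q)).trace.re ^ (1 / q) *
        (Yᴴ * Y).trace.re := by
  have hA' := hA.isHermitian
  have hB' := hB.isHermitian
  set U := eigenMatrix hA' with hU
  set V := eigenMatrix hB' with hV
  -- Changing to the two eigenbases keeps `K` a contraction, so its squared entries are still
  -- substochastic.
  have hK' : IsContraction (Uᴴ * K * V) :=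
    ((isContraction_eigenMatrix hA').conjTranspose.mul hK).mul (isContraction_eigenMatrix hB')
  have hY' : ((Vᴴ * Y * U)ᴴ * (Vᴴ * Y * U)).trace.re ≤ (Yᴴ * Y).trace.re := by
    refine ((isContraction_eigenMatrix hA').trace_conj_le_right _).trans ?_
    rw [Matrix.trace_mul_comm]
    exact (isContraction_eigenMatrix hB').conjTranspose.trace_conj_le Y
  have hY0 : 0 ≤ ((Vᴴ * Y * U)ᴴ * (Vᴴ * Y * U)).trace.re := by
    rw [trace_conjTranspose_mul_self]; positivity
  rw [psdPow, psdPow, trace_cfc_mul_mul_cfc_mul hA' hB', ← hU, ← hV]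
  have hx : ∀ i, 0 ≤ (hA'.eigenvalues i ^ a) ^ 2 := fun i => by positivity
  have hy : ∀ i, 0 ≤ (hB'.eigenvalues i ^ b) ^ 2 := fun i => by positivity
  have h2 := sum_substochastic_le hK' hx hy hpq
  have e1 : ∀ (z c r : ℝ), 0 ≤ z → ((z ^ c) ^ 2) ^ r = z ^ (2 * c * r) := fun z c r hz => by
    rw [← Real.rpow_natCast, ← Real.rpow_mul hz, ← Real.rpow_mul hz]
    congr 1; push_cast; ring
  simp only [e1 _ _ _ (hA.eigenvalues_nonneg _), e1 _ _ _ (hB.eigenvalues_nonneg _)] at h2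
  rw [trace_psdPow hA, trace_psdPow hB]
  refine le_trans ?_ (mul_le_mul h2 hY' hY0 ?_)
  · rw [trace_conjTranspose_mul_self]
    refine le_trans (pow_le_pow_left₀ (norm_nonneg _) (norm_sum_le _ _) 2) ?_
    -- Cauchy-Schwarz over pairs of indices separates `Y` from `K` and the eigenvalues.
    have h3 := Finset.sum_mul_sq_le_sq_mul_sq (Finset.univ : Finset (n × n))
      (fun z => ‖(Uᴴ * K * V) z.1 z.2‖ * (hA'.eigenvalues z.1 ^ a * hB'.eigenvalues z.2 ^ b))
      (fun z => ‖(Vᴴ * Y * U) z.2 z.1‖)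
    convert h3 using 1
    · refine congrArg (· ^ 2) (Finset.sum_congr rfl fun z _ => ?_)
      simp only [norm_mul, Complex.norm_real, Real.norm_eq_abs,
        abs_of_nonneg (Real.rpow_nonneg (hA.eigenvalues_nonneg _) _),
        abs_of_nonneg (Real.rpow_nonneg (hB.eigenvalues_nonneg _) _)]
      ring
    · refine congrArg₂ (· * ·) (Finset.sum_congr rfl fun z _ => by ring) ?_
      rw [Fintype.sum_prod_type, Fintype.sum_prod_type_right]
  · exact mul_nonneg
      (Real.rpow_nonneg (Finset.sum_nonneg fun i _ =>
        Real.rpow_nonneg (hA.eigenvalues_nonneg i) _) _)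
      (Real.rpow_nonneg (Finset.sum_nonneg fun i _ =>
        Real.rpow_nonneg (hB.eigenvalues_nonneg i) _) _)

lemma trace_cfc_mul_conj {A B : Matrix n n ℂ} (hA : A.IsHermitian) (hB : B.IsHermitian)
    (f g : ℝ → ℝ) (M : Matrix n n ℂ) :
    (cfc f A * M * cfc g B * Mᴴ).trace.re = ∑ x : n × n,
      ‖((eigenMatrix hA)ᴴ * M * eigenMatrix hB) x.1 x.2‖ ^ 2 *
        (f (hA.eigenvalues x.1) * g (hB.eigenvalues x.2)) := by
  rw [trace_cfc_mul_mul_cfc_mul hA hB, Complex.re_sum]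
  refine Finset.sum_congr rfl fun x _ => ?_
  have : (eigenMatrix hB)ᴴ * Mᴴ * eigenMatrix hA = ((eigenMatrix hA)ᴴ * M * eigenMatrix hB)ᴴ := by
    simp [Matrix.mul_assoc]
  rw [this, conjTranspose_apply, ← Complex.normSq_eq_norm_sq, Complex.normSq_apply]
  simp
  ring

/-- A Jensen inequality for a two-sided pairing with powers. -/
lemma trace_psdPow_mul_conj_le {A B M : Matrix n n ℂ} (hA : A.PosSemidef) (hB : B.PosSemidef)
    {t : ℝ} (h0 : 0 < t) (h1 : t < 1) (r : ℝ) :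
    (psdPow A t * M * psdPow B (r * t) * Mᴴ).trace.re ≤
      (A * M * psdPow B r * Mᴴ).trace.re ^ t * (M * Mᴴ).trace.re ^ (1 - t) := by
  have hA' := hA.isHermitian
  have hB' := hB.isHermitian
  have e1 : (A * M * psdPow B r * Mᴴ).trace.re = _ :=
    (congrArg (fun Z => (Z * M * psdPow B r * Mᴴ).trace.re) (cfc_id ℝ A hA')).symm.trans
      (trace_cfc_mul_conj hA' hB' id (fun x => x ^ r) M)
  have e2 := trace_cfc_mul_conj hA' hB' (fun _ => 1) (fun _ => 1) M
  rw [cfc_const_one ℝ A hA'.isSelfAdjoint, cfc_const_one ℝ B hB'.isSelfAdjoint,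
    Matrix.one_mul, Matrix.mul_one] at e2
  rw [e1, e2, psdPow, psdPow, trace_cfc_mul_conj hA' hB']
  simp only [id, mul_one]
  have h := sum_weight_rpow_le (Finset.univ : Finset (n × n))
    (fun x => ‖((eigenMatrix hA')ᴴ * M * eigenMatrix hB') x.1 x.2‖ ^ 2)
    (fun x => hA'.eigenvalues x.1 * hB'.eigenvalues x.2 ^ r) (fun _ _ => by positivity)
    (fun x _ => mul_nonneg (hA.eigenvalues_nonneg _) (Real.rpow_nonneg (hB.eigenvalues_nonneg _) _))
    h0 h1
  refine le_trans (le_of_eq (Finset.sum_congr rfl fun x _ => ?_)) h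
  rw [Real.mul_rpow (hA.eigenvalues_nonneg _) (Real.rpow_nonneg (hB.eigenvalues_nonneg _) _),
    ← Real.rpow_mul (hB.eigenvalues_nonneg _)]

/-! ### The trace norm and the fidelity -/

lemma traceNorm_nonneg (X : Matrix n n ℂ) : 0 ≤ traceNorm X :=
  trace_psdPow_nonneg (posSemidef_conjTranspose_mul_self X) _

lemma trace_polar_mul (X : Matrix n n ℂ) : ((polar X)ᴴ * X).trace = traceNorm X := by
  rw [polar_conjTranspose_mul, traceNorm]
  have h := (psdPow_posSemidef (posSemidef_conjTranspose_mul_self X) (1 / 2)).trace_nonneg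
  exact Complex.ext rfl (Complex.le_def.mp h).2.symm

/-- By polar decomposition `K X = L |X|` with `L` a contraction; in an eigenbasis of `|X|` the
diagonal entries of `L` have modulus at most one. Together with `trace_polar_mul` this is the
variational formula for the trace norm. -/
lemma norm_trace_mul_le_traceNorm {K : Matrix n n ℂ} (hK : IsContraction K) (X : Matrix n n ℂ) :
    ‖(K * X).trace‖ ≤ traceNorm X := by
  have h := posSemidef_conjTranspose_mul_self X
  have hL := hK.mul (isContraction_polar X)
  set L := K * polar X
  have hX : K * X = L * psdPow (Xᴴ * X) (1 / 2) := by rw [Matrix.mul_assoc, polar_mul]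
  rw [hX, traceNorm, trace_psdPow h, psdPow]
  set V := eigenMatrix h.isHermitian with hV
  have hL' : IsContraction (Vᴴ * L * V) :=
    ((isContraction_eigenMatrix h.isHermitian).conjTranspose.mul hL).mul
      (isContraction_eigenMatrix h.isHermitian)
  rw [cfc_eq_conj h.isHermitian, ← hV]
  set D := diagonal (fun i => ((h.isHermitian.eigenvalues i ^ (1 / 2 : ℝ) : ℝ) : ℂ))
  have : (L * (V * D * Vᴴ)).trace = ((Vᴴ * L * V) * D).trace := by
    rw [← Matrix.mul_assoc, Matrix.trace_mul_comm]
    simp only [Matrix.mul_assoc]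
  rw [this]
  simp only [trace, diag_apply, D, Matrix.mul_diagonal]
  refine (norm_sum_le _ _).trans (Finset.sum_le_sum fun i _ => ?_)
  have hs : 0 ≤ h.isHermitian.eigenvalues i ^ (1 / 2 : ℝ) :=
    Real.rpow_nonneg (h.eigenvalues_nonneg i) _
  rw [norm_mul, Complex.norm_real, Real.norm_eq_abs, abs_of_nonneg hs]
  refine mul_le_of_le_one_left hs ?_
  have h1 := (Finset.single_le_sum (f := fun j => ‖(Vᴴ * L * V) j i‖ ^ 2)
    (fun _ _ => by positivity) (Finset.mem_univ i)).trans (hL'.sum_col_le i)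
  exact (sq_le_one_iff₀ (norm_nonneg _)).mp h1

lemma traceNorm_conjTranspose_le (X : Matrix n n ℂ) : traceNorm X ≤ traceNorm Xᴴ := by
  have h := norm_trace_mul_le_traceNorm (isContraction_polar X) Xᴴ
  rw [Matrix.trace_mul_comm, ← conjTranspose_conjTranspose (polar X), ← conjTranspose_mul,
    trace_conjTranspose, trace_polar_mul, norm_star, Complex.norm_real, Real.norm_eq_abs,
    abs_of_nonneg (traceNorm_nonneg X)] at h
  exact h

lemma traceNorm_conjTranspose (X : Matrix n n ℂ) : traceNorm Xᴴ = traceNorm X :=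
  le_antisymm (by simpa using traceNorm_conjTranspose_le Xᴴ) (traceNorm_conjTranspose_le X)

lemma fidelity_comm (ω τ : Matrix n n ℂ) : fidelity ω τ = fidelity τ ω := by
  rw [fidelity, fidelity, ← traceNorm_conjTranspose, conjTranspose_mul, psdPow_conjTranspose,
    psdPow_conjTranspose]

lemma fidelity_nonneg (ω τ : Matrix n n ℂ) : 0 ≤ fidelity ω τ := sq_nonneg _

lemma fidelity_eq_norm_sq (ω τ : Matrix n n ℂ) : ∃ U : Matrix n n ℂ, IsContraction U ∧
    (U * (psdPow ω (1 / 2) * psdPow τ (1 / 2))).trace =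
      traceNorm (psdPow ω (1 / 2) * psdPow τ (1 / 2)) ∧
    fidelity ω τ = ‖(U * (psdPow ω (1 / 2) * psdPow τ (1 / 2))).trace‖ ^ 2 := by
  refine ⟨_, (isContraction_polar (psdPow ω (1 / 2) * psdPow τ (1 / 2))).conjTranspose,
    trace_polar_mul _, ?_⟩
  rw [trace_polar_mul, Complex.norm_real, Real.norm_eq_abs, sq_abs, fidelity]

/-! ### Triangle inequality for the fidelity angle -/

/-- For the Hilbert-Schmidt inner product, remove from `X` and `Y` their components along the unit
vector `Z` and apply Cauchy-Schwarz to the remainders. This is the addition formula for the cosine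
in disguise. -/
lemma re_trace_conjTranspose_mul_ge {X Y Z : Matrix n n ℂ} (hX : (Xᴴ * X).trace.re ≤ 1)
    (hY : (Yᴴ * Y).trace.re ≤ 1) (hZ : (Zᴴ * Z).trace = 1) {a b : ℝ}
    (ha : (Xᴴ * Z).trace = a) (hb : (Yᴴ * Z).trace = b) :
    a * b - ‖(Xᴴ * Y).trace‖ ≤ √(1 - a ^ 2) * √(1 - b ^ 2) := by
  have ha' : (Zᴴ * X).trace = a := by
    rw [← conjTranspose_conjTranspose X, ← conjTranspose_mul, trace_conjTranspose, ha]; simp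
  have hb' : (Zᴴ * Y).trace = b := by
    rw [← conjTranspose_conjTranspose Y, ← conjTranspose_mul, trace_conjTranspose, hb]; simp
  have hXX : ((X - (a : ℂ) • Z)ᴴ * (X - (a : ℂ) • Z)).trace.re ≤ 1 - a ^ 2 := by
    simp [Matrix.sub_mul, Matrix.mul_sub, ha, ha', hZ]
    nlinarith
  have hYY : ((Y - (b : ℂ) • Z)ᴴ * (Y - (b : ℂ) • Z)).trace.re ≤ 1 - b ^ 2 := by
    simp [Matrix.sub_mul, Matrix.mul_sub, hb, hb', hZ]
    nlinarith
  have hXY : ((X - (a : ℂ) • Z)ᴴ * (Y - (b : ℂ) • Z)).trace = (Xᴴ * Y).trace - (a * b : ℝ) := by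
    simp [Matrix.sub_mul, Matrix.mul_sub, ha, hb', hZ]
  have h := norm_trace_conjTranspose_mul_sq_le (X - (a : ℂ) • Z) (Y - (b : ℂ) • Z)
  have hX0 : 0 ≤ ((X - (a : ℂ) • Z)ᴴ * (X - (a : ℂ) • Z)).trace.re := by
    rw [trace_conjTranspose_mul_self]; positivity
  have hY0 : 0 ≤ ((Y - (b : ℂ) • Z)ᴴ * (Y - (b : ℂ) • Z)).trace.re := by
    rw [trace_conjTranspose_mul_self]; positivity
  rw [hXY] at h
  have h2 := h.trans (mul_le_mul hXX hYY hY0 (hX0.trans hXX))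
  rw [← Real.sqrt_mul (hX0.trans hXX)]
  refine le_trans ?_ (Real.le_sqrt_of_sq_le h2)
  have h3 := norm_sub_norm_le ((a * b : ℝ) : ℂ) (Xᴴ * Y).trace
  rw [norm_sub_rev, Complex.norm_real] at h3
  exact (sub_le_sub_right (Real.le_norm_self _) _).trans h3

lemma one_sub_epsPrime {ε₁ ε₂ : ℝ} (h₁ : ε₁ ∈ Set.Icc (0 : ℝ) 1) (h₂ : ε₂ ∈ Set.Icc (0 : ℝ) 1) :
    1 - epsPrime ε₁ ε₂ = (√(1 - ε₁) * √(1 - ε₂) - √ε₁ * √ε₂) ^ 2 := by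
  have e1 := Real.sq_sqrt h₁.1
  have e2 := Real.sq_sqrt h₂.1
  have e3 := Real.sq_sqrt (sub_nonneg.mpr h₁.2)
  have e4 := Real.sq_sqrt (sub_nonneg.mpr h₂.2)
  rw [epsPrime]
  linear_combination (-(√ε₂ ^ 2 + √(1 - ε₂) ^ 2)) * e1 - (√ε₂ ^ 2 + √(1 - ε₂) ^ 2) * e3 - e2 - e4

/-- For `εᵢ = sin² θᵢ` this says `cos (θ₁ + θ₂) ≥ 0`, which is needed before squaring the triangle
inequality. -/
lemma sqrt_mul_sqrt_le {ε₁ ε₂ : ℝ} (h : ε₁ + ε₂ ≤ 1) :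
    √ε₁ * √ε₂ ≤ √(1 - ε₁) * √(1 - ε₂) := by
  rw [mul_comm (√(1 - ε₁))]
  exact mul_le_mul (Real.sqrt_le_sqrt (by linarith)) (Real.sqrt_le_sqrt (by linarith))
    (Real.sqrt_nonneg _) (Real.sqrt_nonneg _)

lemma trace_sqrt_mul_conj_le {ρ U : Matrix n n ℂ} (hρ : ρ.PosSemidef) (hU : IsContraction U) :
    ((U * psdPow ρ (1 / 2)) * (U * psdPow ρ (1 / 2))ᴴ).trace.re ≤ ρ.trace.re := by
  rw [Matrix.trace_mul_comm]
  refine (hU.trace_conj_le _).trans_eq ?_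
  rw [psdPow_conjTranspose, sqrt_mul_sqrt hρ]

/-- The triangle inequality for the fidelity of subnormalized states. -/
lemma one_sub_epsPrime_le_fidelity {ρ ρ₀ ρ₁ : Matrix n n ℂ} (hρ : IsState ρ) {ε₁ ε₂ : ℝ}
    (h₁ : ε₁ ∈ Set.Icc (0 : ℝ) 1) (h₂ : ε₂ ∈ Set.Icc (0 : ℝ) 1) (h : ε₁ + ε₂ ≤ 1)
    (h₀ : ρ₀ ∈ nearby ε₁ ρ) (h₁' : ρ₁ ∈ nearby ε₂ ρ) :
    1 - epsPrime ε₁ ε₂ ≤ fidelity ρ₀ ρ₁ := by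
  obtain ⟨⟨p0, t0⟩, f0⟩ := h₀
  obtain ⟨⟨p1, t1⟩, f1⟩ := h₁'
  obtain ⟨U, hU, eU, -⟩ := fidelity_eq_norm_sq ρ₀ ρ
  obtain ⟨V, hV, eV, -⟩ := fidelity_eq_norm_sq ρ₁ ρ
  set a := traceNorm (psdPow ρ₀ (1 / 2) * psdPow ρ (1 / 2)) with ha
  set b := traceNorm (psdPow ρ₁ (1 / 2) * psdPow ρ (1 / 2)) with hb
  have hZ : ((psdPow ρ (1 / 2))ᴴ * psdPow ρ (1 / 2)).trace = 1 := by
    rw [psdPow_conjTranspose, sqrt_mul_sqrt hρ.1, hρ.2]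
  -- As in Uhlmann's theorem, `U √ρ₀` and `V √ρ₁` act as purifications whose overlaps with `√ρ` are
  -- exactly the root fidelities `a` and `b`; contractions suffice in place of unitaries.
  have key := re_trace_conjTranspose_mul_ge (X := (U * psdPow ρ₀ (1 / 2))ᴴ)
    (Y := (V * psdPow ρ₁ (1 / 2))ᴴ)
    (by rw [conjTranspose_conjTranspose]; exact (trace_sqrt_mul_conj_le p0 hU).trans t0)
    (by rw [conjTranspose_conjTranspose]; exact (trace_sqrt_mul_conj_le p1 hV).trans t1) hZ
    (by rw [conjTranspose_conjTranspose, Matrix.mul_assoc]; exact eU)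
    (by rw [conjTranspose_conjTranspose, Matrix.mul_assoc]; exact eV)
  have h3 : ‖((U * psdPow ρ₀ (1 / 2))ᴴᴴ * (V * psdPow ρ₁ (1 / 2))ᴴ).trace‖ ≤
      traceNorm (psdPow ρ₀ (1 / 2) * psdPow ρ₁ (1 / 2)) := by
    have h4 := norm_trace_mul_le_traceNorm (hV.conjTranspose.mul hU)
      (psdPow ρ₀ (1 / 2) * psdPow ρ₁ (1 / 2))
    rw [Matrix.mul_assoc, Matrix.trace_mul_comm] at h4
    simpa only [conjTranspose_conjTranspose, conjTranspose_mul, psdPow_conjTranspose,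
      Matrix.mul_assoc] using h4
  have ha' : √(1 - ε₁) ≤ a := Real.sqrt_le_iff.mpr ⟨traceNorm_nonneg _, f0⟩
  have hb' : √(1 - ε₂) ≤ b := Real.sqrt_le_iff.mpr ⟨traceNorm_nonneg _, f1⟩
  have ha2 : √(1 - a ^ 2) ≤ √ε₁ := Real.sqrt_le_sqrt (by change 1 - ε₁ ≤ a ^ 2 at f0; linarith)
  have hb2 : √(1 - b ^ 2) ≤ √ε₂ := Real.sqrt_le_sqrt (by change 1 - ε₂ ≤ b ^ 2 at f1; linarith)
  have h5 := mul_le_mul ha' hb' (Real.sqrt_nonneg _) (traceNorm_nonneg _)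
  have h6 := mul_le_mul ha2 hb2 (Real.sqrt_nonneg _) (Real.sqrt_nonneg _)
  rw [one_sub_epsPrime h₁ h₂]
  exact pow_le_pow_left₀ (sub_nonneg.mpr (sqrt_mul_sqrt_le h)) (by linarith) 2

/-! ### Comparison inequalities for the sandwiched quantities -/

lemma mul_eq_zero_of_supp_le {A B : Matrix n n ℂ} (h : supp A ≤ supp B) {M : Matrix n n ℂ}
    (hM : B * M = 0) : A * M = 0 := by
  have h' : LinearMap.ker (Matrix.toEuclideanLin B) ≤ LinearMap.ker (Matrix.toEuclideanLin A) := by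
    have := Submodule.orthogonal_le h
    simpa only [supp, Submodule.orthogonal_orthogonal] using this
  ext i j
  have hj : WithLp.toLp 2 (fun k => M k j) ∈ LinearMap.ker (Matrix.toEuclideanLin B) := by
    rw [LinearMap.mem_ker]
    ext k
    simpa [Matrix.toEuclideanLin, Matrix.mulVec, dotProduct, Matrix.mul_apply] using
      congrFun (congrFun hM k) j
  have hi := congrArg (fun v : EuclideanSpace ℂ n => v i) (LinearMap.mem_ker.mp (h' hj))
  simpa [Matrix.toEuclideanLin, Matrix.mulVec, dotProduct, Matrix.mul_apply] using hi

lemma sqrt_mul_eq_zero_iff {A M : Matrix n n ℂ} (hA : A.PosSemidef) :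
    psdPow A (1 / 2) * M = 0 ↔ A * M = 0 := by
  rw [← conjTranspose_mul_self_mul_eq_zero, psdPow_conjTranspose, sqrt_mul_sqrt hA]

lemma sandwichedQ_nonneg {ρ σ : Matrix n n ℂ} (hρ : ρ.PosSemidef) (α : ℝ) :
    0 ≤ sandwichedQ α ρ σ := by
  refine trace_psdPow_nonneg ?_ α
  have := hρ.conjTranspose_mul_mul_same (psdPow σ ((1 - α) / (2 * α)))
  rwa [psdPow_conjTranspose] at this

lemma sandwich_eq {ρ σ : Matrix n n ℂ} (hρ : ρ.PosSemidef) (s : ℝ) :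
    psdPow σ s * ρ * psdPow σ s =
      (psdPow ρ (1 / 2) * psdPow σ s)ᴴ * (psdPow ρ (1 / 2) * psdPow σ s) := by
  rw [conjTranspose_mul, psdPow_conjTranspose, psdPow_conjTranspose]
  nth_rw 1 [← sqrt_mul_sqrt hρ]
  simp only [Matrix.mul_assoc]

/-- The Hölder-type comparison of the sandwiched quantities of conjugate orders. -/
lemma fidelity_le_sandwichedQ_mul {ρ₀ ρ₁ σ : Matrix n n ℂ} (h₀ : ρ₀.PosSemidef)
    (h₁ : ρ₁.PosSemidef) (hσ : σ.PosSemidef) (hs : supp ρ₀ ≤ supp σ) {α β : ℝ}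
    (hα : α ∈ Set.Ioo (1 / 2 : ℝ) 1) (hβ : β = α / (2 * α - 1)) :
    fidelity ρ₀ ρ₁ ≤ sandwichedQ β ρ₀ σ ^ (1 / β) * sandwichedQ α ρ₁ σ ^ (1 / α) := by
  obtain ⟨ha, ha'⟩ := hα
  have hα0 : 0 < α := by linarith
  have h2α : 0 < 2 * α - 1 := by linarith
  have h1α : 0 < 1 - α := by linarith
  have hpq : β.HolderConjugate (α / (1 - α)) := by
    rw [Real.holderConjugate_iff, hβ]
    refine ⟨by rw [lt_div_iff₀ h2α]; linarith, ?_⟩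
    field_simp
    ring
  have hβ0 := hpq.pos
  -- Conjugate orders give opposite exponents of `σ`, so the two sandwiching powers cancel.
  have hss : (1 - β) / (2 * β) = -((1 - α) / (2 * α)) := by
    have h1 : β * (2 * α - 1) = α := by rw [hβ, div_mul_cancel₀ _ h2α.ne']
    rw [← neg_div, div_eq_div_iff (by positivity) (by positivity)]
    linear_combination (-2) * h1
  have hs0 : 0 < (1 - α) / (2 * α) := by positivity
  set t := (1 - α) / (2 * α) with ht
  obtain ⟨A, hA⟩ : ∃ Z, Z = psdPow ρ₀ (1 / 2) * psdPow σ (-t) := ⟨_, rfl⟩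
  obtain ⟨B, hB⟩ : ∃ Z, Z = psdPow ρ₁ (1 / 2) * psdPow σ t := ⟨_, rfl⟩
  have hG := posSemidef_conjTranspose_mul_self A
  have hS := posSemidef_conjTranspose_mul_self B
  have hQβ : sandwichedQ β ρ₀ σ = (psdPow (Aᴴ * A) β).trace.re := by
    rw [sandwichedQ, hss, sandwich_eq h₀, ← hA]
  have hQα : sandwichedQ α ρ₁ σ = (psdPow (Bᴴ * B) α).trace.re := by
    rw [sandwichedQ, sandwich_eq h₁, ← hB]
  have hAB : A * Bᴴ = psdPow ρ₀ (1 / 2) * psdPow ρ₁ (1 / 2) := by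
    rw [hA, hB, conjTranspose_mul, psdPow_conjTranspose, psdPow_conjTranspose, Matrix.mul_assoc,
      ← Matrix.mul_assoc (psdPow σ (-t)), psdPow_mul_psdPow_neg hσ (by linarith) (by ring),
      ← Matrix.mul_assoc, mul_suppProj_of_ker hσ]
    exact fun M hM => (sqrt_mul_eq_zero_iff h₀).mpr (mul_eq_zero_of_supp_le hs hM)
  -- This value meets two demands: `1 - 2b = α`, so `Tr Y Yᴴ` is `Q_α`, and `2bq = α` for the Hölder
  -- exponent `q = α / (1 - α)`.
  set b := (1 - α) / 2 with hb
  have hb0 : 0 < b := by positivity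
  obtain ⟨Y, hY⟩ : ∃ Z, Z = psdPow (Bᴴ * B) (-b) * Bᴴ := ⟨_, rfl⟩
  have hSY : psdPow (Bᴴ * B) b * Y = Bᴴ := by
    rw [hY, ← Matrix.mul_assoc, psdPow_mul_psdPow_neg hS hb0.ne' (by ring)]
    have := congrArg Matrix.conjTranspose (mul_suppProj_self B)
    rwa [conjTranspose_mul, suppProj_conjTranspose] at this
  have hYY : (Y * Yᴴ).trace.re = (psdPow (Bᴴ * B) α).trace.re := by
    have : Y * Yᴴ = psdPow (Bᴴ * B) (-b) * psdPow (Bᴴ * B) 1 * psdPow (Bᴴ * B) (-b) := by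
      rw [hY, conjTranspose_mul, psdPow_conjTranspose, psdPow_one hS, conjTranspose_conjTranspose]
      simp only [Matrix.mul_assoc]
    have e1 : -b + 1 + -b = α := by rw [hb]; ring
    rw [this, psdPow_mul_psdPow hS (by linarith), psdPow_mul_psdPow hS (by linarith), e1]
  obtain ⟨U, hU, -, hF⟩ := fidelity_eq_norm_sq ρ₀ ρ₁
  have hUW := hU.mul (isContraction_polar A)
  have htr : (U * (psdPow ρ₀ (1 / 2) * psdPow ρ₁ (1 / 2))).trace =
      (psdPow (Aᴴ * A) (1 / 2) * 1 * psdPow (Bᴴ * B) b * (Y * (U * polar A))).trace := by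
    rw [← hAB, Matrix.mul_one, Matrix.mul_assoc, ← Matrix.mul_assoc _ Y, hSY,
      ← Matrix.mul_assoc Bᴴ, ← Matrix.mul_assoc, Matrix.trace_mul_comm,
      Matrix.trace_mul_comm (psdPow _ _), Matrix.mul_assoc _ (polar A), polar_mul,
      ← Matrix.mul_assoc]
  rw [hF, htr, hQβ, hQα]
  refine (norm_trace_sq_le_holder hG hS isContraction_one _ hpq (1 / 2) b).trans ?_
  have e2 : 2 * (1 / 2) * β = β := by ring
  have e3 : 2 * b * (α / (1 - α)) = α := by rw [hb]; field_simp
  rw [e2, e3, mul_assoc]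
  refine mul_le_mul_of_nonneg_left ?_ (Real.rpow_nonneg (trace_psdPow_nonneg hG _) _)
  have hq0 := trace_psdPow_nonneg hS α
  calc _ ≤ (psdPow (Bᴴ * B) α).trace.re ^ (1 / (α / (1 - α))) *
        (psdPow (Bᴴ * B) α).trace.re ^ (1 : ℝ) := by
        rw [Real.rpow_one]
        exact mul_le_mul_of_nonneg_left ((hUW.trace_conj_le_right Y).trans_eq hYY)
          (Real.rpow_nonneg hq0 _)
    _ = _ := by
        have e4 : 1 / (α / (1 - α)) + 1 = 1 / α := by field_simp; ring
        rw [← Real.rpow_add' hq0 (by rw [e4]; positivity), e4]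

/-- The limiting case of `fidelity_le_sandwichedQ_mul` of order infinity. -/
lemma fidelity_le_mul_fidelity {ρ₀ ρ₁ σ : Matrix n n ℂ} (h₀ : ρ₀.PosSemidef)
    (hσ : σ.PosSemidef) {l : ℝ} (hl : 0 ≤ l) (hle : ((l : ℂ) • σ - ρ₀).PosSemidef) :
    fidelity ρ₀ ρ₁ ≤ l * fidelity ρ₁ σ := by
  -- If `l σ M = 0`, compressing `l σ - ρ₀ ≥ 0` by `M` leaves `-Mᴴ ρ₀ M ≥ 0`, which forces `√ρ₀ M =
  -- 0`.
  have hker : ∀ M : Matrix n n ℂ, (l : ℂ) • (σ * M) = 0 → psdPow ρ₀ (1 / 2) * M = 0 := by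
    intro M hM
    rw [← trace_conjTranspose_mul_self_eq_zero_iff]
    have h1 := (hle.conjTranspose_mul_mul_same M).trace_nonneg
    have h2 := (posSemidef_conjTranspose_mul_self (psdPow ρ₀ (1 / 2) * M)).trace_nonneg
    have h3 : (psdPow ρ₀ (1 / 2) * M)ᴴ * (psdPow ρ₀ (1 / 2) * M) = Mᴴ * (ρ₀ * M) := by
      rw [conjTranspose_mul, psdPow_conjTranspose, Matrix.mul_assoc,
        ← Matrix.mul_assoc _ _ M, sqrt_mul_sqrt h₀]
    rw [Matrix.mul_assoc, Matrix.sub_mul, smul_mul, hM, zero_sub, Matrix.mul_neg, trace_neg,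
      ← h3] at h1
    exact le_antisymm (neg_nonneg.mp h1) h2
  obtain ⟨U, hU, -, hF⟩ := fidelity_eq_norm_sq ρ₀ ρ₁
  rcases hl.eq_or_lt with rfl | hl'
  · have : psdPow ρ₀ (1 / 2) = 0 := by simpa using hker 1 (by simp)
    rw [hF, this]
    simp
  obtain ⟨C, hC⟩ : ∃ Z, Z = psdPow ρ₀ (1 / 2) * psdPow σ (-(1 / 2)) := ⟨_, rfl⟩
  have hCσ : C * psdPow σ (1 / 2) = psdPow ρ₀ (1 / 2) := by
    rw [hC, Matrix.mul_assoc, psdPow_mul_psdPow_neg hσ (by norm_num) (by ring),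
      mul_suppProj_of_ker hσ]
    exact fun M hM => hker M (by rw [hM, smul_zero])
  have hP : psdPow σ (-(1 / 2)) * σ * psdPow σ (-(1 / 2)) = suppProj σ := by
    nth_rw 2 [← psdPow_one hσ]
    rw [psdPow_mul_psdPow hσ (by norm_num), psdPow_mul_psdPow_neg hσ (by norm_num) (by norm_num)]
  -- Compressing `ρ₀ ≤ l σ` by `σ^(-1/2)` gives `Cᴴ C ≤ l P` with `P` the support projection of `σ`;
  -- hence `√ρ₀ = √l K √σ` for a contraction `K`.
  have hK : IsContraction (((√l)⁻¹ : ℂ) • C) := by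
    have h1 := hle.conjTranspose_mul_mul_same (psdPow σ (-(1 / 2)))
    rw [psdPow_conjTranspose, Matrix.mul_sub, Matrix.sub_mul, Matrix.mul_smul, Matrix.smul_mul, hP,
      sandwich_eq h₀, ← hC] at h1
    have h2 : (((l⁻¹ : ℝ) : ℂ) • ((l : ℂ) • suppProj σ - Cᴴ * C)).PosSemidef :=
      h1.smul (Complex.zero_le_real.mpr (inv_nonneg.mpr hl))
    have h3 := isContraction_suppProj σ
    rw [IsContraction, suppProj_conjTranspose, suppProj_mul_self] at h3
    unfold IsContraction
    convert h3.add h2 using 1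
    have hl2 : ((√l : ℝ) : ℂ) * ((√l : ℝ) : ℂ) = l := by
      rw [← Complex.ofReal_mul, Real.mul_self_sqrt hl]
    rw [smul_sub, smul_smul, ← Complex.ofReal_mul, inv_mul_cancel₀ hl'.ne', Complex.ofReal_one,
      one_smul, sub_add_sub_cancel]
    simp [smul_smul, ← mul_inv, hl2]
  have h4 := norm_trace_mul_le_traceNorm (hU.mul hK) (psdPow σ (1 / 2) * psdPow ρ₁ (1 / 2))
  have h5 : (U * (((√l)⁻¹ : ℂ) • C) * (psdPow σ (1 / 2) * psdPow ρ₁ (1 / 2))).trace =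
      ((√l)⁻¹ : ℂ) * (U * (psdPow ρ₀ (1 / 2) * psdPow ρ₁ (1 / 2))).trace := by
    rw [← hCσ]
    simp [Matrix.mul_assoc]
  have hsl : 0 < √l := Real.sqrt_pos.mpr hl'
  rw [h5, norm_mul, norm_inv, Complex.norm_real, Real.norm_eq_abs, abs_of_pos hsl,
    inv_mul_le_iff₀ hsl] at h4
  rw [hF, fidelity_comm ρ₁, fidelity]
  refine (pow_le_pow_left₀ (norm_nonneg _) h4 2).trans_eq ?_
  rw [mul_pow, Real.sq_sqrt hl]

/-- The comparison of the sandwiched quantity of order `β > 1` with the fidelity. -/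
lemma fidelity_le_sandwichedQ_mul_fidelity {ρ₀ ρ₁ σ : Matrix n n ℂ} (h₀ : ρ₀.PosSemidef)
    (h₁ : IsSubState ρ₁) (hσ : σ.PosSemidef) (hs : supp ρ₀ ≤ supp σ) {β : ℝ} (hβ : 1 < β) :
    fidelity ρ₀ ρ₁ ≤ sandwichedQ β ρ₀ σ ^ (1 / β) * fidelity ρ₁ σ ^ ((β - 1) / β) := by
  have hβ0 : 0 < β := by linarith
  have hβ1 : 0 < β - 1 := by linarith
  set θ := (β - 1) / β with hθ
  have hθ0 : 0 < θ := by positivity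
  have hθ1 : θ < 1 := by rw [hθ, div_lt_one hβ0]; linarith
  have hpq : (1 / θ).HolderConjugate β := by
    refine (Real.holderConjugate_iff.mpr ⟨hβ, ?_⟩).symm
    rw [hθ]; field_simp; ring
  have hss : (1 - β) / (2 * β) = -(θ / 2) := by rw [hθ]; field_simp; ring
  obtain ⟨R, hR⟩ : ∃ Z, Z = psdPow ρ₁ (1 / 2) := ⟨_, rfl⟩
  have hRR : Rᴴ = R := by rw [hR, psdPow_conjTranspose]
  obtain ⟨A, hA⟩ : ∃ Z, Z = psdPow ρ₀ (1 / 2) * psdPow σ (-(θ / 2)) := ⟨_, rfl⟩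
  obtain ⟨X, hX⟩ : ∃ Z, Z = psdPow σ (1 / 2) * R := ⟨_, rfl⟩
  have hG := posSemidef_conjTranspose_mul_self A
  obtain ⟨S, hSdef⟩ : ∃ Z, Z = Xᴴ * X := ⟨_, rfl⟩
  have hS : S.PosSemidef := hSdef ▸ posSemidef_conjTranspose_mul_self X
  have hSσ : S = R * σ * R := by
    rw [hSdef, hX, conjTranspose_mul, psdPow_conjTranspose, hRR]
    nth_rw 3 [← sqrt_mul_sqrt hσ]
    simp only [Matrix.mul_assoc]
  have hQβ : sandwichedQ β ρ₀ σ = (psdPow (Aᴴ * A) β).trace.re := by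
    rw [sandwichedQ, hss, sandwich_eq h₀, ← hA]
  have hf : fidelity ρ₁ σ = (psdPow S (1 / 2)).trace.re ^ 2 := by
    rw [fidelity_comm, fidelity, traceNorm, ← hR, ← hX, ← hSdef]
  set f := (psdPow S (1 / 2)).trace.re with hfdef
  have hf0 : 0 ≤ f := trace_psdPow_nonneg hS _
  have hAR : A * (psdPow σ (θ / 2) * R) = psdPow ρ₀ (1 / 2) * R := by
    rw [hA, Matrix.mul_assoc, ← Matrix.mul_assoc (psdPow σ (-(θ / 2))),
      psdPow_mul_psdPow_neg hσ (by linarith) (by ring), ← Matrix.mul_assoc, mul_suppProj_of_ker hσ]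
    exact fun M hM => (sqrt_mul_eq_zero_iff h₀).mpr (mul_eq_zero_of_supp_le hs hM)
  -- The exponent `θ / 4` is chosen so that Hölder with exponent `1 / θ` returns `Tr S^(1/2)`, the
  -- root fidelity of `ρ₁` and `σ`.
  obtain ⟨Y, hY⟩ : ∃ Z, Z = psdPow σ (θ / 2) * R * psdPow S (-(θ / 4)) := ⟨_, rfl⟩
  have hYS : Y * psdPow S (θ / 4) = psdPow σ (θ / 2) * R := by
    rw [hY, Matrix.mul_assoc, psdPow_mul_psdPow_neg hS (by linarith) (by ring),
      mul_suppProj_of_ker hS]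
    intro M hM
    rw [hSdef, conjTranspose_mul_self_mul_eq_zero, hX, Matrix.mul_assoc] at hM
    rw [Matrix.mul_assoc]
    exact psdPow_mul_eq_zero hσ (by positivity) hM
  have hYY : (Yᴴ * Y).trace.re ≤ f ^ θ := by
    have h1 : (Yᴴ * Y).trace = (psdPow σ θ * R * psdPow S (-(1 / 2) * θ) * Rᴴ).trace := by
      have e1 : θ = θ / 2 + θ / 2 := by ring
      have e2 : -(1 / 2) * θ = -(θ / 4) + -(θ / 4) := by ring
      have e3 : psdPow σ θ = psdPow σ (θ / 2) * psdPow σ (θ / 2) := by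
        rw [psdPow_mul_psdPow hσ (by linarith), ← e1]
      rw [Matrix.trace_mul_comm, hY, conjTranspose_mul, conjTranspose_mul, psdPow_conjTranspose,
        psdPow_conjTranspose, e2, ← psdPow_mul_psdPow hS (by linarith), e3]
      conv_rhs => rw [Matrix.mul_assoc, Matrix.mul_assoc, Matrix.mul_assoc, Matrix.trace_mul_comm]
      simp only [Matrix.mul_assoc]
    have h2 : (σ * R * psdPow S (-(1 / 2)) * Rᴴ).trace.re = f := by
      rw [Matrix.trace_mul_comm, hRR, ← Matrix.mul_assoc, ← Matrix.mul_assoc, ← hSσ]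
      nth_rw 1 [← psdPow_one hS]
      rw [psdPow_mul_psdPow hS (by norm_num), hfdef]
      norm_num
    have h3 : (R * Rᴴ).trace.re ≤ 1 := by
      rw [hRR, hR, sqrt_mul_sqrt h₁.1]; exact h₁.2
    have h30 : 0 ≤ (R * Rᴴ).trace.re := by
      rw [Matrix.trace_mul_comm, trace_conjTranspose_mul_self]; positivity
    -- Jensen pulls out the power `θ`: the inner trace is `Tr S S^(-1/2) = f`, and the other factor
    -- is a power of `Tr ρ₁ ≤ 1`. This is where subnormalization is used.
    have h4 := trace_psdPow_mul_conj_le (M := R) hσ hS hθ0 hθ1 (-(1 / 2))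
    rw [h2] at h4
    rw [h1]
    exact h4.trans (mul_le_of_le_one_right (Real.rpow_nonneg hf0 _)
      (Real.rpow_le_one h30 h3 (by linarith)))
  obtain ⟨U, hU, -, hF⟩ := fidelity_eq_norm_sq ρ₀ ρ₁
  have hUW := hU.mul (isContraction_polar A)
  have htr : (U * (psdPow ρ₀ (1 / 2) * R)).trace =
      (psdPow S (θ / 4) * (U * polar A) * psdPow (Aᴴ * A) (1 / 2) * Y).trace := by
    rw [← hAR, ← hYS]
    conv_rhs => rw [Matrix.mul_assoc, Matrix.mul_assoc, Matrix.trace_mul_comm]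
    simp only [Matrix.mul_assoc]
    rw [← Matrix.mul_assoc (polar A), polar_mul]
  rw [hF, ← hR, htr, hQβ, hf]
  refine (norm_trace_sq_le_holder hS hG hUW Y hpq (θ / 4) (1 / 2)).trans ?_
  have e2 : 2 * (1 / 2) * β = β := by ring
  have e3 : 2 * (θ / 4) * (1 / θ) = 1 / 2 := by field_simp; norm_num
  rw [e2, e3, one_div_one_div, ← Real.rpow_natCast f 2, ← Real.rpow_mul hf0,
    show ((2 : ℕ) : ℝ) * θ = θ + θ by push_cast; ring, Real.rpow_add' hf0 (by linarith),
    mul_comm (f ^ θ), mul_assoc]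
  exact mul_le_mul_of_nonneg_left (mul_le_mul_of_nonneg_left hYY (Real.rpow_nonneg hf0 _))
    (Real.rpow_nonneg (trace_psdPow_nonneg hG _) _)

end Operators

/-! ### Base-two logarithms -/

lemma log_two_pos : (0 : EReal) < ((Real.log 2 : ℝ) : EReal) := by
  exact_mod_cast Real.log_pos one_lt_two

lemma log2_mono : Monotone log2 := fun _ _ h =>
  EReal.div_le_div_right_of_nonneg log_two_pos.le (ENNReal.log_monotone h)

lemma log2_ofReal {x : ℝ} (hx : 0 < x) :
    log2 (ENNReal.ofReal x) = ((Real.log x / Real.log 2 : ℝ) : EReal) := by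
  rw [log2, ENNReal.log_ofReal_of_pos hx, EReal.coe_div]

lemma log2_zero : log2 0 = ⊥ := by
  rw [log2, ENNReal.log_zero, EReal.bot_div_of_pos_ne_top log_two_pos (EReal.coe_ne_top _)]

lemma log2_top : log2 ⊤ = ⊤ := by
  rw [log2, ENNReal.log_top, EReal.top_div_of_pos_ne_top log_two_pos (EReal.coe_ne_top _)]

lemma log2_one_div_ofReal {x : ℝ} (hx : 0 < x) :
    log2 (1 / ENNReal.ofReal x) = ((-(Real.log x / Real.log 2) : ℝ) : EReal) := by
  rw [one_div, ← ENNReal.ofReal_inv_of_pos hx, log2_ofReal (inv_pos.mpr hx), Real.log_inv, neg_div]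

lemma log2_one_div_zero : log2 (1 / ENNReal.ofReal 0) = ⊤ := by simp [log2_top]

lemma log2_inv (x : ℝ≥0∞) : log2 x⁻¹ = -log2 x := by
  rw [log2, ENNReal.log_inv, log2, EReal.div_eq_inv_mul, EReal.div_eq_inv_mul, mul_neg]

/-- Valid even for `0 * ⊤ = 0`, since `⊥ + ⊤ = ⊥` in `EReal`. -/
lemma log2_mul (x y : ℝ≥0∞) : log2 (x * y) = log2 x + log2 y := by
  rw [log2, ENNReal.log_mul_add, EReal.add_div_of_nonneg_right log_two_pos.le, log2, log2]

lemma log2_ofReal_ne_top (x : ℝ) : log2 (ENNReal.ofReal x) ≠ ⊤ := by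
  rcases le_or_gt x 0 with hx | hx
  · simp [ENNReal.ofReal_eq_zero.mpr hx, log2_zero]
  · rw [log2_ofReal hx]; exact EReal.coe_ne_top _

lemma le_iInf_add_coe {ι : Type*} {S : Set ι} {f : ι → EReal} {a : EReal} {r : ℝ}
    (h : ∀ x ∈ S, a ≤ f x + r) : a ≤ (⨅ x ∈ S, f x) + r := by
  rw [← EReal.sub_le_iff_le_add (.inl (EReal.coe_ne_bot _)) (.inl (EReal.coe_ne_top _))]
  exact le_iInf₂ fun x hx => EReal.sub_le_of_le_add (h x hx)

lemma iInf_ne_bot_of_le_add {ι : Type*} {S : Set ι} {f : ι → EReal} {a : EReal} {r : ℝ}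
    (ha : a ≠ ⊥) (h : ∀ x ∈ S, a ≤ f x + r) : ⨅ x ∈ S, f x ≠ ⊥ := fun hbot => by
  have := le_iInf_add_coe h
  rw [hbot, EReal.bot_add, le_bot_iff] at this
  exact ha this

section Operators

open Matrix

variable {n : Type*} [Fintype n] [DecidableEq n]

/-! ### Pairwise comparison of the entropies -/

lemma sandwichedRenyi_le_add {ρ₀ ρ₁ σ : Matrix n n ℂ} (h₀ : ρ₀.PosSemidef)
    (h₁ : ρ₁.PosSemidef) (hσ : σ.PosSemidef) {α β : ℝ} (hα : α ∈ Set.Ioo (1 / 2 : ℝ) 1)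
    (hβ : β = α / (2 * α - 1)) (hβ1 : 1 < β) {c : ℝ} (hc : 0 < c) (hF : c ≤ fidelity ρ₀ ρ₁) :
    sandwichedRenyi α ρ₁ σ ≤
      sandwichedRenyi β ρ₀ σ + ((β / (β - 1) * -(Real.log c / Real.log 2) : ℝ) : EReal) := by
  by_cases hs : supp ρ₀ ≤ supp σ
  swap
  · rw [sandwichedRenyi.eq_1 β, if_neg (by rw [not_or]; exact ⟨by linarith, hs⟩), EReal.top_add_coe]
    exact le_top
  rw [sandwichedRenyi, if_pos (.inl hα.2), sandwichedRenyi, if_pos (.inr hs)]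
  have hle := hF.trans (fidelity_le_sandwichedQ_mul h₀ h₁ hσ hs hα hβ)
  have hα0 : 0 < α := by linarith [hα.1]
  have hβ0 : 0 < β := by linarith
  have q0 := sandwichedQ_nonneg (σ := σ) h₀ β
  have q1 := sandwichedQ_nonneg (σ := σ) h₁ α
  have q0' : 0 < sandwichedQ β ρ₀ σ := q0.lt_of_ne fun h => by
    rw [← h, Real.zero_rpow (by positivity)] at hle; linarith
  have q1' : 0 < sandwichedQ α ρ₁ σ := q1.lt_of_ne fun h => by
    rw [← h, Real.zero_rpow (by positivity)] at hle; linarith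
  rw [log2_ofReal q0', log2_ofReal q1']
  norm_cast
  have hlog := Real.log_le_log hc hle
  rw [Real.log_mul (Real.rpow_pos_of_pos q0' _).ne' (Real.rpow_pos_of_pos q1' _).ne',
    Real.log_rpow q0', Real.log_rpow q1'] at hlog
  set x := Real.log (sandwichedQ β ρ₀ σ)
  set y := Real.log (sandwichedQ α ρ₁ σ)
  have hl2 := Real.log_pos one_lt_two
  have h1α : 0 < 1 - α := by linarith [hα.2]
  have hb1 : 0 < β - 1 := by linarith
  -- Conjugacy makes the prefactors of both entropies agree after the logarithmic inequality is
  -- scaled by `β / (β - 1)`.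
  have hk : β / (β - 1) = α / (1 - α) := by
    have h1 : β * (2 * α - 1) = α := by rw [hβ, div_mul_cancel₀ _ (by linarith [hα.1])]
    rw [div_eq_div_iff hb1.ne' h1α.ne']
    linear_combination (-1) * h1
  have e1 : 1 / (β - 1) * x = β / (β - 1) * (1 / β * x) := by field_simp
  have e2 : 1 / (α - 1) * y = -(β / (β - 1) * (1 / α * y)) := by
    rw [hk, ← neg_sub 1 α]; field_simp
  rw [← mul_div_assoc, e2, ← mul_div_assoc, e1, ← neg_div, ← mul_div_assoc, ← add_div]
  refine div_le_div_of_nonneg_right ?_ hl2.le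
  have hk0 : 0 ≤ β / (β - 1) := by positivity
  have := mul_le_mul_of_nonneg_left hlog hk0
  linarith

lemma sandwichedRenyi_ne_bot {α : ℝ} (hα : α < 1) (ρ σ : Matrix n n ℂ) :
    sandwichedRenyi α ρ σ ≠ ⊥ := by
  rw [sandwichedRenyi, if_pos (.inl hα)]
  have hneg : 1 / (α - 1) < 0 := one_div_neg.mpr (by linarith)
  rcases le_or_gt (sandwichedQ α ρ σ) 0 with h | h
  · rw [ENNReal.ofReal_eq_zero.mpr h, log2_zero, EReal.coe_mul_bot_of_neg hneg]
    exact bot_ne_top.symm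
  · rw [log2_ofReal h, ← EReal.coe_mul]
    exact EReal.coe_ne_bot _

/-- The comparison is made in `ℝ≥0∞` before taking logarithms, so zero and infinite values need no
separate cases. A general set `S` allows both the nearby operators and the singleton `{ρ}`. -/
lemma neg_log2_iInf_fidelity_le {S : Set (Matrix n n ℂ)} {ρ₀ σ : Matrix n n ℂ}
    (h₀ : ρ₀.PosSemidef) (hσ : σ.PosSemidef) {c : ℝ} (hc : 0 < c)
    (hF : ∀ ρ₁ ∈ S, c ≤ fidelity ρ₀ ρ₁) :
    -log2 (⨅ ρ₁ ∈ S, ENNReal.ofReal (fidelity ρ₁ σ)) ≤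
      maxRelEntropy ρ₀ σ + log2 (1 / ENNReal.ofReal c) := by
  have hc0 : ENNReal.ofReal c ≠ 0 := (ENNReal.ofReal_pos.mpr hc).ne'
  rw [maxRelEntropy, ← log2_mul, ← log2_inv]
  refine log2_mono ?_
  simp only [ENNReal.inv_iInf]
  refine iSup₂_le fun ρ₁ h₁ => ?_
  rw [← div_eq_mul_one_div, ENNReal.le_div_iff_mul_le (.inl hc0) (.inl ENNReal.ofReal_ne_top),
    mul_comm, ← div_eq_mul_inv]
  refine le_iInf₂ fun l hl => ENNReal.div_le_of_le_mul ?_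
  have := (hF ρ₁ h₁).trans (fidelity_le_mul_fidelity h₀ hσ l.coe_nonneg hl)
  refine (ENNReal.ofReal_le_ofReal this).trans_eq ?_
  rw [ENNReal.ofReal_mul l.coe_nonneg, ENNReal.ofReal_coe_nnreal]

lemma smoothMinFRelEntropy_le_sandwichedRenyi_add {ρ σ : Matrix n n ℂ} (hρ : ρ.PosSemidef)
    (hσ : σ.PosSemidef) {ε : ℝ} (hε : ε < 1) {β : ℝ} (hβ : 1 < β) :
    smoothMinFRelEntropy ε ρ σ ≤ sandwichedRenyi β ρ σ +
      ((β / (β - 1) : ℝ) : EReal) * log2 (1 / ENNReal.ofReal (1 - ε)) := by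
  have hc : 0 < 1 - ε := by linarith
  rw [log2_one_div_ofReal hc, ← EReal.coe_mul]
  by_cases hs : supp ρ ≤ supp σ
  swap
  · rw [sandwichedRenyi, if_neg (by rw [not_or]; exact ⟨by linarith, hs⟩), EReal.top_add_coe]
    exact le_top
  rw [sandwichedRenyi, if_pos (.inr hs), smoothMinFRelEntropy]
  have hβ0 : 0 < β := by linarith
  have hb1 : 0 < β - 1 := by linarith
  have hle : ∀ ρ₁ ∈ nearby ε ρ, 1 - ε ≤
      sandwichedQ β ρ σ ^ (1 / β) * fidelity ρ₁ σ ^ ((β - 1) / β) := fun ρ₁ h₁ =>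
    (h₁.2.trans_eq (fidelity_comm _ _)).trans
      (fidelity_le_sandwichedQ_mul_fidelity hρ h₁.1 hσ hs hβ)
  -- If `Q_β = 0`, the bound `hle` contradicts `0 < 1 - ε` for every nearby operator; the infimum is
  -- then over an empty set and the smooth min-entropy is `⊥`.
  rcases (sandwichedQ_nonneg (σ := σ) hρ β).eq_or_lt with hQ | hQ
  · have : ⨅ ρ₁ ∈ nearby ε ρ, ENNReal.ofReal (fidelity ρ₁ σ) = ⊤ := by
      refine top_le_iff.mp (le_iInf₂ fun ρ₁ h₁ => ?_)
      have := hle ρ₁ h₁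
      rw [← hQ, Real.zero_rpow (by positivity), zero_mul] at this
      linarith
    rw [this, log2_top, EReal.neg_top]
    exact bot_le
  set x := Real.log (sandwichedQ β ρ σ) with hx
  set b := β / (β - 1) * (Real.log (1 - ε) - 1 / β * x) with hb
  have hbound : ENNReal.ofReal (Real.exp b) ≤
      ⨅ ρ₁ ∈ nearby ε ρ, ENNReal.ofReal (fidelity ρ₁ σ) := by
    refine le_iInf₂ fun ρ₁ h₁ => ENNReal.ofReal_le_ofReal ?_
    have h2 := hle ρ₁ h₁
    have hF : 0 < fidelity ρ₁ σ := (fidelity_nonneg _ _).lt_of_ne fun h => by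
      rw [← h, Real.zero_rpow (by positivity)] at h2; linarith
    rw [← Real.le_log_iff_exp_le hF]
    have hlog := Real.log_le_log hc h2
    rw [Real.log_mul (Real.rpow_pos_of_pos hQ _).ne' (Real.rpow_pos_of_pos hF _).ne',
      Real.log_rpow hQ, Real.log_rpow hF, ← hx] at hlog
    have e : Real.log (fidelity ρ₁ σ) =
        β / (β - 1) * ((β - 1) / β * Real.log (fidelity ρ₁ σ)) := by field_simp
    rw [hb, e]
    exact mul_le_mul_of_nonneg_left (by linarith) (by positivity)
  refine (EReal.neg_le_neg_iff.mpr (log2_mono hbound)).trans ?_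
  rw [log2_ofReal (Real.exp_pos b), Real.log_exp, log2_ofReal hQ, ← hx]
  norm_cast
  refine le_of_eq ?_
  rw [hb]
  have hl2 := (Real.log_pos one_lt_two).ne'
  field_simp
  ring

/-! ### Passage to the two-sided smooth inequalities -/

lemma epsPrime_mem_Icc {ε₁ ε₂ : ℝ} (h₁ : ε₁ ∈ Set.Icc (0 : ℝ) 1) (h₂ : ε₂ ∈ Set.Icc (0 : ℝ) 1) :
    epsPrime ε₁ ε₂ ∈ Set.Icc (0 : ℝ) 1 :=
  ⟨sq_nonneg _, by
    have := one_sub_epsPrime h₁ h₂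
    have h := sq_nonneg (√(1 - ε₁) * √(1 - ε₂) - √ε₁ * √ε₂)
    linarith⟩

lemma smoothSandwichedRenyi_le_add {ρ σ : Matrix n n ℂ} (hρ : IsState ρ) (hσ : σ.PosSemidef)
    {ε₁ ε₂ : ℝ} (h₁ : ε₁ ∈ Set.Icc (0 : ℝ) 1) (h₂ : ε₂ ∈ Set.Icc (0 : ℝ) 1) (h : ε₁ + ε₂ ≤ 1)
    (hne : ε₁ ≠ 1) {α β : ℝ} (hα : α ∈ Set.Ioo (1 / 2 : ℝ) 1) (hβ : β = α / (2 * α - 1))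
    (hβ1 : 1 < β) :
    smoothSandwichedRenyi ε₂ α ρ σ ≤ smoothSandwichedRenyi ε₁ β ρ σ +
      ((β / (β - 1) : ℝ) : EReal) * log2 (1 / ENNReal.ofReal (1 - epsPrime ε₁ ε₂)) := by
  rw [smoothSandwichedRenyi, if_pos hα.2, smoothSandwichedRenyi, if_neg (by linarith)]
  have hk : 0 < β / (β - 1) := div_pos (by linarith) (by linarith)
  -- If `ε' = 1` the correction is `⊤`, and it only remains to exclude `⊥` for the smooth entropy.
  -- Comparing with `ρ₁ = ρ` does this, as `F(ρ₀, ρ) ≥ 1 - ε₁ > 0`.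
  rcases (sub_nonneg.mpr (epsPrime_mem_Icc h₁ h₂).2).eq_or_lt with hc | hc
  · rw [← hc, log2_one_div_zero, EReal.coe_mul_top_of_pos hk, EReal.add_top_of_ne_bot]
    · exact le_top
    · exact iInf_ne_bot_of_le_add (sandwichedRenyi_ne_bot hα.2 ρ σ) fun ρ₀ h₀ =>
        sandwichedRenyi_le_add h₀.1.1 hρ.1 hσ hα hβ hβ1
          (sub_pos.mpr (lt_of_le_of_ne h₁.2 hne)) h₀.2
  · rw [log2_one_div_ofReal hc, ← EReal.coe_mul]
    exact iSup₂_le fun ρ₁ h₁' => le_iInf_add_coe fun ρ₀ h₀ =>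
      sandwichedRenyi_le_add h₀.1.1 h₁'.1.1 hσ hα hβ hβ1 hc
        (one_sub_epsPrime_le_fidelity hρ h₁ h₂ h h₀ h₁')

lemma smoothMinFRelEntropy_le_smoothMaxRelEntropy_add {ρ σ : Matrix n n ℂ} (hρ : IsState ρ)
    (hσ : σ.PosSemidef) {ε₁ ε₂ : ℝ} (h₁ : ε₁ ∈ Set.Icc (0 : ℝ) 1) (h₂ : ε₂ ∈ Set.Icc (0 : ℝ) 1)
    (h : ε₁ + ε₂ ≤ 1) (hne : ε₁ ≠ 1) :
    smoothMinFRelEntropy ε₂ ρ σ ≤ smoothMaxRelEntropy ε₁ ρ σ +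
      log2 (1 / ENNReal.ofReal (1 - epsPrime ε₁ ε₂)) := by
  rw [smoothMaxRelEntropy]
  rcases (sub_nonneg.mpr (epsPrime_mem_Icc h₁ h₂).2).eq_or_lt with hc | hc
  · rw [← hc, log2_one_div_zero, EReal.add_top_of_ne_bot]
    · exact le_top
    · have hc1 : 0 < 1 - ε₁ := sub_pos.mpr (lt_of_le_of_ne h₁.2 hne)
      -- The singleton `{ρ}` replaces the nearby set: the finite constant `1 - ε₁` then bounds the
      -- fidelity, which keeps the infimum away from `⊥`.
      refine iInf_ne_bot_of_le_add (a := -log2 (⨅ ρ₁ ∈ ({ρ} : Set (Matrix n n ℂ)),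
        ENNReal.ofReal (fidelity ρ₁ σ))) (r := -(Real.log (1 - ε₁) / Real.log 2)) ?_ ?_
      · rw [iInf_singleton, Ne, EReal.neg_eq_bot_iff]
        exact log2_ofReal_ne_top _
      · intro ρ₀ h₀
        rw [← log2_one_div_ofReal hc1]
        exact neg_log2_iInf_fidelity_le h₀.1.1 hσ hc1 fun ρ₁ h => h ▸ h₀.2
  · rw [log2_one_div_ofReal hc]
    refine le_iInf_add_coe fun ρ₀ h₀ => ?_
    rw [← log2_one_div_ofReal hc]
    exact neg_log2_iInf_fidelity_le h₀.1.1 hσ hc fun ρ₁ h₁' =>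
      one_sub_epsPrime_le_fidelity hρ h₁ h₂ h h₀ h₁'

end Operators
end SmoothMinF
end

theorem mainTheorem6 {n : Type*} [Fintype n] [DecidableEq n] (ρ σ : Matrix n n ℂ)
    (hρ : SmoothMinF.IsState ρ) (hσ : σ.PosSemidef) :
    (∀ ε₁ ∈ Set.Icc (0 : ℝ) 1, ∀ ε₂ ∈ Set.Icc (0 : ℝ) 1, ε₁ + ε₂ ≤ 1 →
      SmoothMinF.epsPrime ε₁ ε₂ ∈ Set.Icc (0 : ℝ) 1 ∧
      -- for `ε₁ = 1` the left-hand sides below would be the undefined `(-∞) + (+∞)`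
      (ε₁ ≠ 1 →
        (∀ α ∈ Set.Ioo (1 / 2 : ℝ) 1, ∀ β : ℝ, β = α / (2 * α - 1) →
          1 < β ∧
          SmoothMinF.smoothSandwichedRenyi ε₁ β ρ σ
              + ((β / (β - 1) : ℝ) : EReal) *
                SmoothMinF.log2 (1 / ENNReal.ofReal (1 - SmoothMinF.epsPrime ε₁ ε₂))
            ≥ SmoothMinF.smoothSandwichedRenyi ε₂ α ρ σ) ∧
        SmoothMinF.smoothMaxRelEntropy ε₁ ρ σ
            + SmoothMinF.log2 (1 / ENNReal.ofReal (1 - SmoothMinF.epsPrime ε₁ ε₂))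
          ≥ SmoothMinF.smoothMinFRelEntropy ε₂ ρ σ)) ∧
    (∀ ε ∈ Set.Ico (0 : ℝ) 1, ∀ β : ℝ, 1 < β →
      SmoothMinF.sandwichedRenyi β ρ σ
          + ((β / (β - 1) : ℝ) : EReal) * SmoothMinF.log2 (1 / ENNReal.ofReal (1 - ε))
        ≥ SmoothMinF.smoothMinFRelEntropy ε ρ σ) := by
  refine ⟨fun ε₁ h₁ ε₂ h₂ h => ⟨SmoothMinF.epsPrime_mem_Icc h₁ h₂, fun hne =>
    ⟨fun α hα β hβ => ?_,
      SmoothMinF.smoothMinFRelEntropy_le_smoothMaxRelEntropy_add hρ hσ h₁ h₂ h hne⟩⟩,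
    fun ε hε β hβ =>
      SmoothMinF.smoothMinFRelEntropy_le_sandwichedRenyi_add hρ.1 hσ hε.2 hβ⟩
  have hβ1 : 1 < β := by
    rw [hβ, lt_div_iff₀ (by linarith [hα.1])]
    linarith [hα.2]
  exact ⟨hβ1, SmoothMinF.smoothSandwichedRenyi_le_add hρ hσ h₁ h₂ h hne hα hβ hβ1⟩
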